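/- A probabilistic sentential decision diagram (PSDD) over the variables $X_1,\dots,X_n$ consists of a vtree (a full binary tree whose leaves are labelled bijectively by the variables) and a finite rooted directed acyclic graph whose root is normalized for the root of the vtree. A node normalized for a leaf labelled $X_i$ is a literal $X_i$ or $\overline{X_i}$, or a terminal with a parameter $0<\theta<1$, with value $\theta$ if $X_i=1$ and $1-\theta$ if $X_i=0$. A node normalized for an inner vtree node is a decision node $\{(p_j,s_j,\theta_j)\}_j$, with value $\sum_j\theta_j\,p_j\,s_j$; its primes $p_j$ are normalized for the left child and its subs $s_j$ for the right child, the Boolean functions underlying the primes are consistent, mutually exclusive and exhaustive, and $\theta_j\ge 0$, $\sum_j\theta_j=1$, with $\theta_j=0$ if and only if $s_j$ is false. The constant false is allowed as a node for every vtree node. The size of a PSDD is its number of nodes. The L-ensemble with kernel $L\in\mathbb{R}^{n\times n}$ is the distribution $\Pr(\mathbf X=\mathbf x)=\det(L_{\mathbf x})/\det(L+I)$ on $\{0,1\}^n$, where $L_{\mathbf x}$ is the submatrix of $L$ indexed by $\{i : x_i=1\}$. A PSDD represents a distribution if its root value is proportional to it. **Theorem.** Let $n\ge 1$ and $M>0$,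 let $B$ be drawn from the uniform distribution over $[-M,M]^{n\times n}$, and let $L=B^{T}B$. Then with probability $1$ the L-ensemble with kernel $L$ cannot be tractably represented by any PSDD, in the following sense: 1. for all $n\ge 1$ and $M>0$, with probability $1$ every PSDD that represents the L-ensemble with kernel $L$ has size at least $2^{n-1}$; 2. consequently, for every polynomial $p$ with natural number coefficients there is an $N$, depending only on $p$, such that for all $n\ge \max(N,1)$ and all $M>0$, with probability $1$ every PSDD that represents the L-ensemble with kernel $L$ has size greater than $p(n)$. -/

import Mathlib

/-- Full binary trees whose leaves are labelled by variables. -/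
inductive Vtree (V : Type) : Type
  | leaf (v : V) : Vtree V
  | node (left right : Vtree V) : Vtree V

namespace Vtree

/-- The labels of the leaves, from left to right. -/
def leaves {V : Type} : Vtree V → List V
  | leaf v => [v]
  | node l r => l.leaves ++ r.leaves

/-- A vtree for the variable set `V`: every variable labels exactly one leaf. -/
def IsVtree {V : Type} (T : Vtree V) : Prop :=
  T.leaves.Nodup ∧ ∀ v : V, v ∈ T.leaves

end Vtree

/-- The possible labels of a node of a PSDD over the variables `V`, where `C` is the type of
possible children.  `lit v b` is the literal `v` (if `b` is true) or its negation (if `b` is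
false); `top v θ` is the parametrized terminal node for `v`; `bot` is the constant false; `dec` is
a decision node with elements `(prime j, sub j, θ j)`. -/
inductive PSDDLabel (V C : Type) : Type
  | lit (v : V) (b : Bool) : PSDDLabel V C
  | top (v : V) (θ : ℝ) : PSDDLabel V C
  | bot : PSDDLabel V C
  | dec (k : ℕ) (prime sub : Fin k → C) (θ : Fin k → ℝ) : PSDDLabel V C

/-- A finite directed acyclic graph of labelled nodes.  The nodes are numbered in a topological
order: the children of node `i` have numbers below `i`. A node can be shared by several parents. -/
structure PSDDGraph (V : Type) : Type where
  /-- the number of nodes -/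
  size : ℕ
  /-- the label (and the children) of every node -/
  label : (i : Fin size) → PSDDLabel V (Fin i.val)

namespace PSDDGraph

variable {V : Type}

/-- A child of the node `i`, as a node of the graph. -/
def child (G : PSDDGraph V) (i : Fin G.size) (c : Fin i.val) : Fin G.size :=
  Fin.castLE i.isLt.le c

/-- The base of a node: the Boolean function (the SDD) that underlies it. -/
def Sat (G : PSDDGraph V) (x : V → Bool) (i : Fin G.size) : Prop :=
  match G.label i with
  | .lit v b => x v = b
  | .top _ _ => True
  | .bot => False
  | .dec k prime sub _ =>
      ∃ j : Fin k, G.Sat x (G.child i (prime j)) ∧ G.Sat x (G.child i (sub j))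
termination_by i.val
decreasing_by all_goals simp [child]

/-- The value of a node at an assignment.  A decision node is a weighted sum, with weights `θ j`,
of the products of a prime and its sub; a terminal `top v θ` gives `θ` to `v` being true and
`1 - θ` to `v` being false. -/
noncomputable def val (G : PSDDGraph V) (x : V → Bool) (i : Fin G.size) : ℝ :=
  match G.label i with
  | .lit v b => if x v = b then 1 else 0
  | .top v θ => if x v = true then θ else 1 - θ
  | .bot => 0
  | .dec k prime sub θ =>
      ∑ j : Fin k, θ j * (G.val x (G.child i (prime j)) * G.val x (G.child i (sub j)))
termination_by i.val
decreasing_by all_goals simp [child]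

/-- `G.IsNode T i`: the subgraph rooted at the node `i` is a PSDD normalized for the vtree `T`.
At a leaf, it is a literal, or a terminal with a parameter strictly between `0` and `1`.  At an
inner vtree node, it is a decision node whose primes are normalized for the left child and whose
subs are normalized for the right child; the primes are consistent, mutually exclusive and
exhaustive; and the parameters are nonnegative, sum to one, and vanish exactly at the subs that are
false.  The constant false is allowed everywhere. -/
inductive IsNode (G : PSDDGraph V) : Vtree V → Fin G.size → Prop
  | lit (i : Fin G.size) (v : V) (b : Bool) (h : G.label i = .lit v b) :
      G.IsNode (.leaf v) i
  | top (i : Fin G.size) (v : V) (θ : ℝ) (h : G.label i = .top v θ)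
      (pos : 0 < θ) (lt_one : θ < 1) :
      G.IsNode (.leaf v) i
  | bot (T : Vtree V) (i : Fin G.size) (h : G.label i = .bot) :
      G.IsNode T i
  | dec (l r : Vtree V) (i : Fin G.size) (k : ℕ) (prime sub : Fin k → Fin i.val) (θ : Fin k → ℝ)
      (h : G.label i = .dec k prime sub θ)
      (prime_node : ∀ j, G.IsNode l (G.child i (prime j)))
      (sub_node : ∀ j, G.IsNode r (G.child i (sub j)))
      (consistent : ∀ j, ∃ x : V → Bool, G.Sat x (G.child i (prime j)))
      (partition : ∀ x : V → Bool, ∃! j, G.Sat x (G.child i (prime j)))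
      (nonneg : ∀ j, 0 ≤ θ j)
      (sum_eq_one : ∑ j, θ j = 1)
      (eq_zero_iff : ∀ j, θ j = 0 ↔ ∀ x : V → Bool, ¬ G.Sat x (G.child i (sub j))) :
      G.IsNode (.node l r) i

end PSDDGraph

/-- A probabilistic sentential decision diagram over the variables `V`; its size is its number of
nodes, `size`. -/
structure PSDD (V : Type) : Type extends PSDDGraph V where
  /-- the vtree that the diagram respects -/
  vtree : Vtree V
  vtree_isVtree : vtree.IsVtree
  /-- the root node -/
  root : Fin size
  root_isNode : toPSDDGraph.IsNode vtree root

/-- The probability of the assignment `x` under the L-ensemble with kernel `L`. -/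
noncomputable def lEnsemble {n : ℕ} (L : Matrix (Fin n) (Fin n) ℝ) (x : Fin n → Bool) : ℝ :=
  (L.submatrix (fun i : {i : Fin n // x i = true} => i.val)
    (fun i : {i : Fin n // x i = true} => i.val)).det / (L + 1).det

/-- The PSDD represents the distribution `P`: its value is proportional to `P`. -/
def PSDD.Represents {V : Type} (D : PSDD V) (P : (V → Bool) → ℝ) : Prop :=
  ∃ c : ℝ, 0 < c ∧ ∀ x : V → Bool, D.val x D.root = c * P x

/-- The uniform distribution on the cube `[-M, M]^{n × n}`. -/
noncomputable def uniformCube (n : ℕ) (M : ℝ) : MeasureTheory.Measure (Fin n → Fin n → ℝ) :=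
  ProbabilityTheory.cond MeasureTheory.volume
    {B : Fin n → Fin n → ℝ | ∀ i j, B i j ∈ Set.Icc (-M) M}

/-!
Write the odds of a variable `v` at an assignment `x` of the other variables for the ratio of the
probabilities of the two extensions of `x`. Let `v` be the last variable of the vtree. Since the
primes of a decision node are mutually exclusive, and do not depend on `v`, evaluating a PSDD at `x`
follows a single path down the right spine of the vtree, through the subs of the satisfied primes,
to a terminal node for `v`. The values at the two extensions of `x` share all factors but the one
from that terminal, so its parameter `θ` gives the odds `θ / (1 - θ)` of `v` at `x`
(`PSDDGraph.exists_terminal`). If all probabilities are nonzero and the odds of `v` differ for any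
two of the `2 ^ (n - 1)` assignments of the other variables, these lead to different terminal nodes
(`PSDD.two_pow_le_size`).

For an L-ensemble the odds are ratios of principal minors of `Bᵀ B`. That two of them differ says
that a polynomial in the entries of `B` does not vanish; it is not the zero polynomial, as a shear
matrix `B` witnesses (`ae_odds_ne`), and the zero set of a nonzero polynomial is null
(`MvPolynomial.ae_eval_uncurry_ne_zero`). The uniform distribution on the cube is absolutely
continuous, so all of this holds with probability one.
-/

open MeasureTheory

/-! ### Values of a PSDD along the right spine of its vtree -/

namespace Vtree

/-- The label of the last leaf, at the end of the right spine of the vtree. -/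
def lastLeaf {V : Type} : Vtree V → V
  | leaf v => v
  | node _ r => r.lastLeaf

theorem lastLeaf_mem_leaves {V : Type} (T : Vtree V) : T.lastLeaf ∈ T.leaves := by
  induction T with
  | leaf v => simp [lastLeaf, leaves]
  | node l r _ ihr => simp [lastLeaf, leaves, ihr]

end Vtree

namespace PSDDGraph

variable {V : Type} {G : PSDDGraph V}

theorem sat_of_val_ne_zero {T : Vtree V} {i : Fin G.size} (hi : G.IsNode T i) {x : V → Bool}
    (hx : G.val x i ≠ 0) : G.Sat x i := by
  induction hi with
  | lit i v b h =>
    unfold val at hx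
    unfold Sat
    simp only [h] at hx ⊢
    by_contra hne
    simp [hne] at hx
  | top i v θ h =>
    unfold Sat
    simp only [h]
  | bot T i h =>
    unfold val at hx
    simp [h] at hx
  | dec l r i k prime sub θ h _ _ _ _ _ _ _ ihp ihs =>
    unfold val at hx
    unfold Sat
    simp only [h] at hx ⊢
    obtain ⟨j, -, hj⟩ := Finset.exists_ne_zero_of_sum_ne_zero hx
    exact ⟨j, ihp j (left_ne_zero_of_mul (right_ne_zero_of_mul hj)),
      ihs j (right_ne_zero_of_mul (right_ne_zero_of_mul hj))⟩

theorem val_congr {T : Vtree V} {i : Fin G.size} (hi : G.IsNode T i) {x y : V → Bool}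
    (hxy : ∀ v ∈ T.leaves, x v = y v) : G.val x i = G.val y i := by
  induction hi with
  | lit i v b h =>
    unfold val
    simp only [h, hxy v (by simp [Vtree.leaves])]
  | top i v θ h =>
    unfold val
    simp only [h, hxy v (by simp [Vtree.leaves])]
  | bot T i h =>
    unfold val
    simp only [h]
  | dec l r i k prime sub θ h _ _ _ _ _ _ _ ihp ihs =>
    unfold val
    simp only [h]
    refine Finset.sum_congr rfl fun j _ => ?_
    rw [ihp j fun v hv => hxy v (by simp [Vtree.leaves, hv]),
      ihs j fun v hv => hxy v (by simp [Vtree.leaves, hv])]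

/-- Following the satisfied primes down the right spine of the vtree: if the value of a node
vanishes for neither truth value of the last variable `v`, the odds of `v` given the other
variables are the odds `θ / (1 - θ)` of some terminal node for `v`. -/
theorem exists_terminal [DecidableEq V] {T : Vtree V} {i : Fin G.size} (hi : G.IsNode T i)
    (hT : T.leaves.Nodup) {x : V → Bool}
    (h0 : G.val (Function.update x T.lastLeaf false) i ≠ 0)
    (h1 : G.val (Function.update x T.lastLeaf true) i ≠ 0) :
    ∃ t θ, G.label t = .top T.lastLeaf θ ∧
      θ * G.val (Function.update x T.lastLeaf false) i =
        (1 - θ) * G.val (Function.update x T.lastLeaf true) i := by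
  induction hi with
  | lit i v b h =>
    unfold val at h0 h1
    cases b <;> simp [h, Vtree.lastLeaf] at h0 h1
  | top i v θ h =>
    refine ⟨i, θ, h, ?_⟩
    unfold val
    simp [h, Vtree.lastLeaf, mul_comm]
  | bot T i h =>
    unfold val at h0
    simp [h] at h0
  | dec l r i k prime sub θ h hp hs _ hpart _ _ _ _ ihs =>
    obtain ⟨-, hr, hlr⟩ := List.nodup_append'.1 hT
    simp only [Vtree.lastLeaf] at h0 h1 ⊢
    set v := r.lastLeaf
    have hv : v ∉ l.leaves := fun hmem => hlr hmem r.lastLeaf_mem_leaves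
    obtain ⟨j, -, hj⟩ := hpart x
    -- The primes do not depend on `v`, so the same element is active for both values of `v`.
    have key (b : Bool) : G.val (Function.update x v b) i =
        θ j * (G.val x (G.child i (prime j)) *
          G.val (Function.update x v b) (G.child i (sub j))) := by
      have hpx (m) : G.val (Function.update x v b) (G.child i (prime m)) =
          G.val x (G.child i (prime m)) :=
        val_congr (hp m) fun w hw => Function.update_of_ne (by rintro rfl; exact hv hw) _ _
      conv_lhs => unfold val
      simp only [h, hpx]
      refine Finset.sum_eq_single j (fun m _ hm => ?_) (by simp)
      have hz : G.val x (G.child i (prime m)) = 0 := by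
        by_contra hne
        exact hm (hj m (sat_of_val_ne_zero (hp m) hne))
      simp [hz]
    rw [key] at h0 h1
    obtain ⟨t, τ, ht, hτ⟩ := ihs j hr (right_ne_zero_of_mul (right_ne_zero_of_mul h0))
      (right_ne_zero_of_mul (right_ne_zero_of_mul h1))
    refine ⟨t, τ, ht, ?_⟩
    rw [key, key]
    linear_combination θ j * G.val x (G.child i (prime j)) * hτ

end PSDDGraph

/-- If, for every variable `v`, the odds of `v` given the other variables are different for any
two assignments of the other variables, then a PSDD needs a terminal node for each of these
assignments, where `v` is the last variable of its vtree. -/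
theorem PSDD.two_pow_le_size {V : Type} [Fintype V] [DecidableEq V] {P : (V → Bool) → ℝ}
    (hP : ∀ x, P x ≠ 0)
    (hodds : ∀ v x y, x v = false → y v = false → x ≠ y →
      P (Function.update x v true) * P y ≠ P (Function.update y v true) * P x)
    {D : PSDD V} (hD : D.Represents P) : 2 ^ (Fintype.card V - 1) ≤ D.size := by
  obtain ⟨c, hc, hval⟩ := hD
  set v := D.vtree.lastLeaf with hv
  let ext (g : {w // w ≠ v} → Bool) (w : V) : Bool := if h : w = v then false else g ⟨w, h⟩
  have hext (g) : ext g v = false := by simp [ext]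
  have hinj : Function.Injective ext := by
    intro g g' hgg
    funext w
    simpa [ext, w.2] using congrFun hgg w.1
  have hne (x) : D.val x D.root ≠ 0 := by
    rw [hval]
    exact mul_ne_zero hc.ne' (hP x)
  choose t θ ht hθ using fun g : {w // w ≠ v} → Bool =>
    PSDDGraph.exists_terminal D.root_isNode D.vtree_isVtree.1 (x := ext g) (hne _) (hne _)
  have hupd (g) : Function.update (ext g) v false = ext g := by
    rw [← hext g, Function.update_eq_self]
  have ht_inj : Function.Injective t := by
    intro g g' hgg
    by_contra hgne
    have hθg : θ g = θ g' := by
      have := ht g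
      rw [hgg, ht g'] at this
      injection this with _ h
      exact h.symm
    have e := hθ g
    have e' := hθ g'
    rw [← hv, hupd, hval, hval] at e e'
    rw [← hθg] at e'
    have hθ1 : 1 - θ g ≠ 0 := by
      intro h
      rw [h, zero_mul, show θ g = 1 by linarith, one_mul] at e
      exact mul_ne_zero hc.ne' (hP _) e
    refine hodds v _ _ (hext g) (hext g') (hinj.ne hgne) ?_
    refine mul_left_cancel₀ (mul_ne_zero hc.ne' hθ1) ?_
    linear_combination P (ext g) * e' - P (ext g') * e
  have hcard := Fintype.card_le_of_injective t ht_inj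
  simpa [Fintype.card_subtype_compl] using hcard

/-! ### Zero sets of polynomials -/

/-- The zero set of a polynomial that does not vanish everywhere is null. By Fubini, since on each
line through a point where the polynomial does not vanish it has only finitely many zeros, almost
every dilate of the zero set about that point is null, and dilation scales the volume. -/
theorem MvPolynomial.ae_eval_uncurry_ne_zero {ι κ : Type*} [Fintype ι] [Fintype κ]
    (p : MvPolynomial (ι × κ) ℝ) {A : ι → κ → ℝ} (hA : eval (Function.uncurry A) p ≠ 0) :
    ∀ᵐ B : ι → κ → ℝ, eval (Function.uncurry B) p ≠ 0 := by
  have hcont : Continuous fun B : ι → κ → ℝ => eval (Function.uncurry B) p := by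
    refine (MvPolynomial.continuous_eval p).comp (continuous_pi fun ij => ?_)
    exact continuous_apply_apply ij.1 ij.2
  have hline (B : ι → κ → ℝ) :
      ∀ᵐ t : ℝ, eval (Function.uncurry (A + t • B)) p ≠ 0 := by
    let q : Polynomial ℝ :=
      aeval (fun ij => Polynomial.C (A ij.1 ij.2) + Polynomial.X * Polynomial.C (B ij.1 ij.2)) p
    have hq (t : ℝ) : q.eval t = eval (Function.uncurry (A + t • B)) p := by
      simp only [q]
      rw [← Polynomial.coe_evalRingHom, MvPolynomial.aeval_def, MvPolynomial.hom_eval₂,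
        MvPolynomial.eval, MvPolynomial.coe_eval₂Hom]
      congr 1
      · ext; simp
      · funext ij; simp [Function.uncurry, mul_comm t]
    have hq0 : q ≠ 0 := by
      intro h
      apply hA
      have := hq 0
      rwa [h, zero_smul, add_zero, Polynomial.eval_zero, eq_comm] at this
    have hfin : {t | q.IsRoot t}.Finite := Polynomial.finite_setOfPred_isRoot hq0
    filter_upwards [compl_mem_ae_iff.2 (hfin.measure_zero volume)] with t ht
    rw [← hq]
    exact ht
  have hmeas : MeasurableSet
      {z : (ι → κ → ℝ) × ℝ | eval (Function.uncurry (A + z.2 • z.1)) p ≠ 0} := by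
    refine (isOpen_compl_singleton.preimage (hcont.comp ?_)).measurableSet
    fun_prop
  have hswap : ∀ᵐ t : ℝ, ∀ᵐ B : ι → κ → ℝ, eval (Function.uncurry (A + t • B)) p ≠ 0 := by
    refine (Measure.ae_ae_comm
      (p := fun (B : ι → κ → ℝ) (t : ℝ) => eval (Function.uncurry (A + t • B)) p ≠ 0) ?_).1
      (ae_of_all _ hline)
    exact hmeas
  obtain ⟨t, ht, ht0⟩ := (hswap.and (measure_eq_zero_iff_ae_notMem.1
    (measure_singleton (μ := volume) (0 : ℝ)))).exists
  rw [ae_iff] at ht ⊢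
  have hset : {B : ι → κ → ℝ | ¬ eval (Function.uncurry (A + t • B)) p ≠ 0} =
      (t • ·) ⁻¹' ((A + ·) ⁻¹' {B | ¬ eval (Function.uncurry B) p ≠ 0}) := rfl
  rw [hset, Measure.addHaar_preimage_smul volume (by simpa using ht0), measure_preimage_add] at ht
  refine (mul_eq_zero.1 ht).resolve_left ?_
  have ht0' : t ≠ 0 := by simpa using ht0
  simp [ht0']

/-! ### Principal minors of the Gram matrix of a shear -/

section PrincipalMinor

variable {n : ℕ} {R : Type*} [CommRing R]

/-- The principal minor of a matrix on the index set described by `x`. -/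
def principalMinor (L : Matrix (Fin n) (Fin n) R) (x : Fin n → Bool) : R :=
  (L.submatrix (fun i : {i : Fin n // x i = true} => i.val)
    (fun i : {i : Fin n // x i = true} => i.val)).det

theorem RingHom.map_principalMinor {S : Type*} [CommRing S] (f : R →+* S)
    (L : Matrix (Fin n) (Fin n) R) (x : Fin n → Bool) :
    f (principalMinor L x) = principalMinor (f.mapMatrix L) x := by
  simp [principalMinor, RingHom.map_det, Matrix.submatrix_map]

theorem principalMinor_one (x : Fin n → Bool) :
    principalMinor (1 : Matrix (Fin n) (Fin n) R) x = 1 := by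
  rw [principalMinor, Matrix.submatrix_one _ Subtype.val_injective, Matrix.det_one]

/-- The Gram matrix of the columns of the shear `1 + E u v`: the column `v` is `e u + e v` and all
others are standard basis vectors. -/
def shearGram {ι : Type*} [Fintype ι] [DecidableEq ι] (R : Type*) [CommRing R] (u v : ι) :
    Matrix ι ι R :=
  (Matrix.transvection u v 1).transpose * Matrix.transvection u v 1

theorem shearGram_apply {ι : Type*} [Fintype ι] [DecidableEq ι] {u v : ι} (huv : u ≠ v) (i j : ι) :
    shearGram R u v i j =
      (if i = j then 1 else 0) + (if i = u ∧ j = v then 1 else 0) +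
        (if i = v ∧ j = u then 1 else 0) + (if i = v ∧ j = v then 1 else 0) := by
  simp only [shearGram, Matrix.transvection, Matrix.mul_add, Matrix.add_mul,
    Matrix.transpose_add, Matrix.transpose_one, Matrix.transpose_single, Matrix.mul_one,
    Matrix.one_mul, Matrix.single_mul_single_same, Matrix.add_apply, Matrix.single_apply,
    Matrix.one_apply]
  grind

theorem principalMinor_shearGram_of_false {u v : Fin n} (huv : u ≠ v) {x : Fin n → Bool}
    (hv : x v = false) : principalMinor (shearGram R u v) x = 1 := by
  have h : (shearGram R u v).submatrix
      (fun i : {i : Fin n // x i = true} => i.val)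
      (fun i : {i : Fin n // x i = true} => i.val) = 1 := by
    ext ⟨i, hi⟩ ⟨j, hj⟩
    rw [Matrix.submatrix_apply, shearGram_apply huv, Matrix.one_apply]
    grind
  rw [principalMinor, h, Matrix.det_one]

/-- If the index set contains both `u` and `v`, the submatrix is the Gram matrix of a smaller
shear. -/
theorem principalMinor_shearGram_of_true_of_true {u v : Fin n} (huv : u ≠ v) {x : Fin n → Bool}
    (hu : x u = true) (hv : x v = true) : principalMinor (shearGram R u v) x = 1 := by
  have huv' : (⟨u, hu⟩ : {i : Fin n // x i = true}) ≠ ⟨v, hv⟩ := by simpa using huv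
  have h : (shearGram R u v).submatrix (fun i : {i : Fin n // x i = true} => i.val)
      (fun i => i.val) = shearGram R ⟨u, hu⟩ ⟨v, hv⟩ := by
    ext ⟨i, hi⟩ ⟨j, hj⟩
    simp only [Matrix.submatrix_apply, shearGram_apply huv, shearGram_apply huv', Subtype.mk.injEq]
  rw [principalMinor, h, shearGram, Matrix.det_mul, Matrix.det_transpose,
    Matrix.det_transvection_of_ne _ _ huv', one_mul]

/-- If the index set contains `v` but not `u`, the columns it selects are orthogonal, and the column
`v` has squared length `2`. -/
theorem principalMinor_shearGram_of_false_of_true {u v : Fin n} (huv : u ≠ v)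
    {x : Fin n → Bool} (hu : x u = false) (hv : x v = true) :
    principalMinor (shearGram R u v) x = 2 := by
  have h : (shearGram R u v).submatrix
      (fun i : {i : Fin n // x i = true} => i.val) (fun i => i.val) =
      Matrix.diagonal fun i => if i = ⟨v, hv⟩ then 2 else 1 := by
    ext ⟨i, hi⟩ ⟨j, hj⟩
    rw [Matrix.submatrix_apply, shearGram_apply huv, Matrix.diagonal_apply]
    have : (2 : R) = 1 + 1 := one_add_one_eq_two.symm
    grind
  rw [principalMinor, h, Matrix.det_diagonal, Finset.prod_ite_eq' Finset.univ _ (fun _ => 2)]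
  simp

end PrincipalMinor

/-! ### Generic L-ensembles -/

/-- The matrix `Bᵀ B` for a matrix `B` of indeterminates. -/
noncomputable def genericGram (n : ℕ) : Matrix (Fin n) (Fin n) (MvPolynomial (Fin n × Fin n) ℝ) :=
  (Matrix.mvPolynomialX (Fin n) (Fin n) ℝ).transpose * Matrix.mvPolynomialX (Fin n) (Fin n) ℝ

theorem mapMatrix_eval_genericGram {n : ℕ} (B : Fin n → Fin n → ℝ) :
    (MvPolynomial.eval (Function.uncurry B)).mapMatrix (genericGram n) =
      (Matrix.of B).transpose * Matrix.of B := by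
  have h := Matrix.mvPolynomialX_mapMatrix_eval (Matrix.of B)
  have h : (MvPolynomial.eval (Function.uncurry B)).mapMatrix
      (Matrix.mvPolynomialX (Fin n) (Fin n) ℝ) = Matrix.of B :=
    Matrix.mvPolynomialX_mapMatrix_eval (Matrix.of B)
  rw [genericGram, map_mul, h]
  congr 1
  exact congrArg Matrix.transpose h

theorem eval_principalMinor_genericGram {n : ℕ} (B : Fin n → Fin n → ℝ) (x : Fin n → Bool) :
    MvPolynomial.eval (Function.uncurry B) (principalMinor (genericGram n) x) =
      principalMinor ((Matrix.of B).transpose * Matrix.of B) x := by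
  rw [RingHom.map_principalMinor, mapMatrix_eval_genericGram]

theorem ae_principalMinor_ne_zero {n : ℕ} (x : Fin n → Bool) :
    ∀ᵐ B : Fin n → Fin n → ℝ, principalMinor ((Matrix.of B).transpose * Matrix.of B) x ≠ 0 := by
  have h := MvPolynomial.ae_eval_uncurry_ne_zero (principalMinor (genericGram n) x)
    (A := Matrix.of.symm 1) (by
      rw [eval_principalMinor_genericGram, Equiv.apply_symm_apply, Matrix.transpose_one, mul_one,
        principalMinor_one]
      exact one_ne_zero)
  simpa only [eval_principalMinor_genericGram] using h

/-- The normalizing constant `det (L + 1)` vanishes almost nowhere, as it is `1` at `B = 0`. -/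
theorem ae_det_gram_add_one_ne_zero (n : ℕ) :
    ∀ᵐ B : Fin n → Fin n → ℝ, ((Matrix.of B).transpose * Matrix.of B + 1).det ≠ 0 := by
  have he (B : Fin n → Fin n → ℝ) :
      MvPolynomial.eval (Function.uncurry B) (genericGram n + 1).det =
        ((Matrix.of B).transpose * Matrix.of B + 1).det := by
    rw [RingHom.map_det, map_add, map_one, mapMatrix_eval_genericGram]
  have h := MvPolynomial.ae_eval_uncurry_ne_zero (genericGram n + 1).det
    (A := Matrix.of.symm 0) (by
      rw [he, Equiv.apply_symm_apply, mul_zero, zero_add, Matrix.det_one]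
      exact one_ne_zero)
  simpa only [he] using h

/-- Generically, the odds of `v` given `x` and given `y` differ. An index `u` at which `x` and `y`
differ yields a shear at which the odds are `1` for one of them and `2` for the other. -/
theorem ae_odds_ne {n : ℕ} {v : Fin n} {x y : Fin n → Bool} (hx : x v = false)
    (hy : y v = false) (hxy : x ≠ y) :
    ∀ᵐ B : Fin n → Fin n → ℝ,
      principalMinor ((Matrix.of B).transpose * Matrix.of B) (Function.update x v true) *
          principalMinor ((Matrix.of B).transpose * Matrix.of B) y ≠
        principalMinor ((Matrix.of B).transpose * Matrix.of B) (Function.update y v true) *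
          principalMinor ((Matrix.of B).transpose * Matrix.of B) x := by
  obtain ⟨u, hu⟩ := Function.ne_iff.1 hxy
  wlog hxu : x u = true generalizing x y
  · have hyu : y u = true := by
      cases hyu : y u <;> simp_all
    filter_upwards [this hy hx hxy.symm hu.symm hyu] with B hB
    exact hB.symm
  have hyu : y u = false := by
    cases hyu : y u <;> simp_all
  have huv : u ≠ v := by
    rintro rfl
    simp_all
  have h := MvPolynomial.ae_eval_uncurry_ne_zero
    (principalMinor (genericGram n) (Function.update x v true) *
        principalMinor (genericGram n) y -
      principalMinor (genericGram n) (Function.update y v true) *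
        principalMinor (genericGram n) x)
    (A := Matrix.of.symm (Matrix.transvection u v 1)) (by
      simp only [map_sub, map_mul, eval_principalMinor_genericGram, Equiv.apply_symm_apply]
      rw [← shearGram, principalMinor_shearGram_of_false huv hx,
        principalMinor_shearGram_of_false huv hy,
        principalMinor_shearGram_of_true_of_true huv (by simp [huv, hxu]) (by simp),
        principalMinor_shearGram_of_false_of_true huv (by simp [huv, hyu]) (by simp)]
      norm_num)
  simpa only [map_sub, map_mul, eval_principalMinor_genericGram, sub_ne_zero] using h

theorem ae_two_pow_le_size (n : ℕ) (M : ℝ) :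
    ∀ᵐ B ∂(uniformCube n M), ∀ D : PSDD (Fin n),
      D.Represents (lEnsemble ((Matrix.of B).transpose * Matrix.of B)) →
        2 ^ (n - 1) ≤ D.size := by
  refine ProbabilityTheory.cond_absolutelyContinuous.ae_le ?_
  have hodds : ∀ᵐ B : Fin n → Fin n → ℝ, ∀ v x y, x v = false → y v = false → x ≠ y →
      principalMinor ((Matrix.of B).transpose * Matrix.of B) (Function.update x v true) *
          principalMinor ((Matrix.of B).transpose * Matrix.of B) y ≠
        principalMinor ((Matrix.of B).transpose * Matrix.of B) (Function.update y v true) *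
          principalMinor ((Matrix.of B).transpose * Matrix.of B) x := by
    simp only [Filter.eventually_all]
    exact fun v x y hx hy hxy => ae_odds_ne hx hy hxy
  filter_upwards [ae_det_gram_add_one_ne_zero n,
    ae_all_iff.2 (ae_principalMinor_ne_zero (n := n)), hodds] with B hdet hminor hodds D hD
  have hsize := PSDD.two_pow_le_size (P := lEnsemble ((Matrix.of B).transpose * Matrix.of B))
    (fun x => div_ne_zero (hminor x) hdet) (fun v x y hx hy hxy heq => ?_) hD
  · simpa using hsize
  · refine hodds v x y hx hy hxy ?_
    change principalMinor _ _ / _ * (principalMinor _ _ / _) =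
      principalMinor _ _ / _ * (principalMinor _ _ / _) at heq
    rw [div_mul_div_comm, div_mul_div_comm] at heq
    exact (div_left_inj' (mul_ne_zero hdet hdet)).1 heq

/-! ### Polynomials against powers of two -/

theorem Polynomial.tendsto_eval_natCast_div_two_pow (p : Polynomial ℕ) :
    Filter.Tendsto (fun n : ℕ => ((p.eval n : ℕ) : ℝ) / 2 ^ n) Filter.atTop (nhds 0) := by
  induction p using Polynomial.induction_on' with
  | add p q hp hq => simpa [add_div] using hp.add hq
  | monomial k a =>
    simpa [mul_div_assoc] using
      (tendsto_pow_const_div_const_pow_of_one_lt k (one_lt_two (α := ℝ))).const_mul (a : ℝ)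

theorem Polynomial.eventually_eval_lt_two_pow_pred (p : Polynomial ℕ) :
    ∀ᶠ n : ℕ in Filter.atTop, p.eval n < 2 ^ (n - 1) := by
  filter_upwards [p.tendsto_eval_natCast_div_two_pow.eventually_lt_const one_half_pos,
    Filter.eventually_ge_atTop 1] with n hn hn1
  obtain ⟨m, rfl⟩ := Nat.exists_eq_add_of_le' hn1
  rw [div_lt_iff₀ (by positivity), pow_succ] at hn
  have : ((p.eval (m + 1) : ℕ) : ℝ) < 2 ^ m := by linarith
  exact_mod_cast this

/-! ### Size of PSDDs for L-ensembles -/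

theorem theorem1 :
    (∀ (n : ℕ) (M : ℝ), 1 ≤ n → 0 < M →
      ∀ᵐ B ∂(uniformCube n M), ∀ D : PSDD (Fin n),
        D.Represents (lEnsemble ((Matrix.of B).transpose * Matrix.of B)) →
          2 ^ (n - 1) ≤ D.size) ∧
    (∀ p : Polynomial ℕ, ∃ N : ℕ, ∀ (n : ℕ) (M : ℝ), 1 ≤ n → N ≤ n → 0 < M →
      ∀ᵐ B ∂(uniformCube n M), ∀ D : PSDD (Fin n),
        D.Represents (lEnsemble ((Matrix.of B).transpose * Matrix.of B)) →
          p.eval n < D.size) := by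
  refine ⟨fun n M _ _ => ae_two_pow_le_size n M, fun p => ?_⟩
  obtain ⟨N, hN⟩ := Filter.eventually_atTop.1 p.eventually_eval_lt_two_pow_pred
  refine ⟨N, fun n M _ hn _ => ?_⟩
  filter_upwards [ae_two_pow_le_size n M] with B hB D hD
  exact (hN n hn).trans_le (hB D hD)
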